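/- Let $A\subset\mathbb{R}^n$ be a homogeneous self-similar set with the strong separation condition: $A$ is nonempty and compact, $q>1$ is an integer, $0<r<1$, and $A=\bigcup_{i=1}^q f_i(A)$, where $f_1,\dots,f_q:\mathbb{R}^n\to\mathbb{R}^n$ are similarities of the same ratio $r$ and the sets $f_1(A),\dots,f_q(A)$ are pairwise disjoint. Let $k$ be the maximal positive integer such that $\sqrt[k]{q}$ is an integer. Let $B\subset\mathbb{R}^{n'}$ be any self-similar set with the strong separation condition: $B$ is nonempty and compact, and $B=\bigcup_{j=1}^m g_j(B)$, where each $g_j:\mathbb{R}^{n'}\to\mathbb{R}^{n'}$ is a similarity of ratio $\beta_j\in(0,1)$ and the sets $g_1(B),\dots,g_m(B)$ are pairwise disjoint. Suppose that $\dim_H A=\dim_H B$. Then the following statements are equivalent: (i) there is a Lipschitz map from $A$ onto $B$; (ii) every similarity ratio $\beta_1,\dots,\beta_m$ is a positive integer power of $\sqrt[k]{r}$; (iii) $A$ and $B$ are bilipschitz equivalent, that is, there is a bijection $A\to B$ such that both it and its inverse are Lipschitz. -/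

import Mathlib

/-- `f` is a similarity of ratio `ρ`: it multiplies every distance by `ρ`. -/
def IsSimilarity {X : Type*} [MetricSpace X] (f : X → X) (ρ : ℝ) : Prop :=
  ∀ x y : X, dist (f x) (f y) = ρ * dist x y

/-- `K` is the self-similar set in `ℝⁿ` of the finitely many contracting similarities `f i`, of
ratios `ρ i`: a nonempty compact set that is the union of its images under the `f i`. -/
structure IsSelfSimilarSet {n m : ℕ}
    (f : Fin m → EuclideanSpace ℝ (Fin n) → EuclideanSpace ℝ (Fin n)) (ρ : Fin m → ℝ)
    (K : Set (EuclideanSpace ℝ (Fin n))) : Prop where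
  ratio_pos : ∀ i, 0 < ρ i
  ratio_lt_one : ∀ i, ρ i < 1
  similarity : ∀ i, IsSimilarity (f i) (ρ i)
  isCompact : IsCompact K
  nonempty : K.Nonempty
  eq_iUnion : K = ⋃ i, f i '' K

/-- The strong separation condition: the pieces `f i '' K` are pairwise disjoint. -/
def StrongSeparation {n m : ℕ}
    (f : Fin m → EuclideanSpace ℝ (Fin n) → EuclideanSpace ℝ (Fin n))
    (K : Set (EuclideanSpace ℝ (Fin n))) : Prop :=
  ∀ i j, i ≠ j → f i '' K ∩ f j '' K = ∅

/-- There is a Lipschitz map of the metric space `X` onto the metric space `Y`. -/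
def LipschitzMapsOnto (X Y : Type*) [MetricSpace X] [MetricSpace Y] : Prop :=
  ∃ f : X → Y, Function.Surjective f ∧ ∃ C : NNReal, LipschitzWith C f

/-- There is a bijection from `X` to `Y` that is Lipschitz and has a Lipschitz inverse. -/
def BilipschitzEquivalent (X Y : Type*) [MetricSpace X] [MetricSpace Y] : Prop :=
  ∃ e : X ≃ Y, (∃ C : NNReal, LipschitzWith C e) ∧ ∃ C : NNReal, LipschitzWith C e.symm

/-! Strong separation lets every point be coded by one infinite word, and the distance of two points
is comparable to the product of the ratios along their common prefix. Hence the ratios alone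
determine the bilipschitz class (`IsDustLike.exists_equiv`), and the dimension `s` solves Moran's
equation. Equality of dimensions thus gives `r ^ s = 1 / q` and makes the `β j ^ s` a probability
vector. Write `q = a ^ k` with `a` not a perfect power, and `ρ = r ^ (1 / k)`, so that `ρ ^ s = 1 /
a`.

If `β j = ρ ^ p j`, Moran's equation becomes the Kraft equality for the lengths `p j` over `a`
letters. A complete prefix code then presents the words over `a` letters, with the ultrametric of
ratio `ρ`, as a set with the ratios of `B`. The code of all words of length `k` does so for `A`, and
both sets are bilipschitz to the same model.

Conversely, under a Lipschitz surjection the preimage of a cylinder of mass `w` is a nonempty union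
of cylinders of `A` of mass `q ^ (-n)` comparable to `w`. Its mass is an integer multiple of `q ^
(-n)`, so the densities (mass of preimage over mass of cylinder) have a positive infimum. Near the
infimum the density can hardly change in a fixed subcylinder, and the counts there are bounded
integers. Discreteness turns the approximate relation into `M * b ^ t = M' * q ^ (-d)`, where `b = β
j ^ s` and the bound on `M, M'` does not depend on `t` (`exists_bounded_counts`). Pigeonhole over
`t` and the primitivity of `a` force `b` to be a power of `1 / a` (`eq_pow_of_bounded_counts`). -/

/-- The product of the ratios `β` along the first `l` letters of `u`. -/
def ratioProd {ι : Type*} (β : ι → ℝ) (u : ℕ → ι) (l : ℕ) : ℝ := ∏ i ∈ Finset.range l, β (u i)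

/-- The composition of the maps `h` along the first `l` letters of `u`. -/
def wordMap {X ι : Type*} (h : ι → X → X) (u : ℕ → ι) : ℕ → X → X
  | 0 => id
  | l + 1 => wordMap h u l ∘ h (u l)

/-- `X`, with the distance function `d`, is the disjoint union of its images under the maps `h i`,
which scale `d` by `β i`; distinct images are uniformly separated. -/
structure IsDustLike {X ι : Type*} (d : X → X → ℝ) (h : ι → X → X) (β : ι → ℝ) : Prop where
  ratio_pos : ∀ i, 0 < β i
  ratio_lt_one : ∀ i, β i < 1
  self : ∀ x, d x x = 0
  nonneg : ∀ x y, 0 ≤ d x y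
  eq_of_zero : ∀ x y, d x y = 0 → x = y
  bounded : ∃ D, ∀ x y, d x y ≤ D
  scaling : ∀ i x y, d (h i x) (h i y) = β i * d x y
  surj : ∀ z, ∃ i x, h i x = z
  separated : ∃ δ > 0, ∀ i j, i ≠ j → ∀ x y, δ ≤ d (h i x) (h j y)
  complete : ∀ u : ℕ → ι, ∃ x, ∀ l, x ∈ Set.range (wordMap h u l)

/-! ### Products of ratios along words. -/

section RatioProd

variable {ι : Type*} {β : ι → ℝ}

@[simp] theorem ratioProd_zero (u : ℕ → ι) : ratioProd β u 0 = 1 := by simp [ratioProd]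

theorem ratioProd_succ (u : ℕ → ι) (l : ℕ) :
    ratioProd β u (l + 1) = ratioProd β u l * β (u l) := Finset.prod_range_succ _ _

theorem ratioProd_pos (hβ : ∀ i, 0 < β i) (u : ℕ → ι) (l : ℕ) : 0 < ratioProd β u l :=
  Finset.prod_pos fun _ _ => hβ _

theorem ratioProd_congr {u v : ℕ → ι} {l : ℕ} (huv : ∀ i < l, u i = v i) :
    ratioProd β u l = ratioProd β v l :=
  Finset.prod_congr rfl fun i hi => by rw [huv i (Finset.mem_range.1 hi)]

theorem ratioProd_antitone (hβ : ∀ i, 0 < β i) (hβ' : ∀ i, β i < 1) (u : ℕ → ι) :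
    Antitone (ratioProd β u) :=
  antitone_nat_of_succ_le fun l => by
    rw [ratioProd_succ]
    exact mul_le_of_le_one_right (ratioProd_pos hβ u l).le (hβ' _).le

theorem ratioProd_le_one (hβ : ∀ i, 0 < β i) (hβ' : ∀ i, β i < 1) (u : ℕ → ι) (l : ℕ) :
    ratioProd β u l ≤ 1 := by
  simpa using ratioProd_antitone hβ hβ' u (Nat.zero_le l)

theorem ratioProd_rpow (hβ : ∀ i, 0 < β i) (s : ℝ) (u : ℕ → ι) (l : ℕ) :
    ratioProd (fun i => β i ^ s) u l = ratioProd β u l ^ s :=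
  Real.finsetProd_rpow _ _ (fun _ _ => (hβ _).le) _

/-- Finitely many ratios have a common bound below one. -/
theorem exists_ratio_bound [Finite ι] (hβ : ∀ i, 0 < β i) (hβ' : ∀ i, β i < 1) :
    ∃ c, 0 ≤ c ∧ c < 1 ∧ ∀ u l, ratioProd β u l ≤ c ^ l := by
  obtain ⟨c, hc0, hc1, hc⟩ : ∃ c, 0 ≤ c ∧ c < 1 ∧ ∀ i, β i ≤ c := by
    rcases isEmpty_or_nonempty ι with hι | hι
    · exact ⟨0, le_rfl, one_pos, fun i => isEmptyElim i⟩
    · obtain ⟨i, hi⟩ := Finite.exists_max β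
      exact ⟨β i, (hβ i).le, hβ' i, hi⟩
  refine ⟨c, hc0, hc1, fun u l => ?_⟩
  calc ratioProd β u l ≤ ∏ _i ∈ Finset.range l, c :=
        Finset.prod_le_prod (fun _ _ => (hβ _).le) fun _ _ => hc _
    _ = c ^ l := by simp

theorem tendsto_ratioProd [Finite ι] (hβ : ∀ i, 0 < β i) (hβ' : ∀ i, β i < 1) (u : ℕ → ι) :
    Filter.Tendsto (ratioProd β u) Filter.atTop (nhds 0) := by
  obtain ⟨c, hc0, hc1, hc⟩ := exists_ratio_bound hβ hβ'
  exact squeeze_zero (fun l => (ratioProd_pos hβ u l).le) (hc u)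
    (tendsto_pow_atTop_nhds_zero_of_lt_one hc0 hc1)

theorem wordMap_congr {X : Type*} (h : ι → X → X) {u v : ℕ → ι} {l : ℕ}
    (huv : ∀ i < l, u i = v i) : wordMap h u l = wordMap h v l := by
  induction l with
  | zero => rfl
  | succ l ih =>
    simp only [wordMap, ih fun i hi => huv i (hi.trans l.lt_succ_self), huv l l.lt_succ_self]

end RatioProd

/-! ### Coding of dust-like spaces by infinite words. -/

namespace IsDustLike

variable {X ι : Type*} {d : X → X → ℝ} {h : ι → X → X} {β : ι → ℝ}

theorem dist_wordMap (H : IsDustLike d h β) (u : ℕ → ι) (l : ℕ) (x y : X) :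
    d (wordMap h u l x) (wordMap h u l y) = ratioProd β u l * d x y := by
  induction l generalizing x y with
  | zero => simp [wordMap]
  | succ l ih => rw [wordMap, Function.comp, Function.comp, ih, H.scaling, ratioProd_succ, mul_assoc]

/-- The point with address `u`. -/
noncomputable def code (H : IsDustLike d h β) (u : ℕ → ι) : X := (H.complete u).choose

theorem code_mem (H : IsDustLike d h β) (u : ℕ → ι) (l : ℕ) :
    H.code u ∈ Set.range (wordMap h u l) := (H.complete u).choose_spec l

theorem eq_code [Finite ι] (H : IsDustLike d h β) {u : ℕ → ι} {x : X}
    (hx : ∀ l, x ∈ Set.range (wordMap h u l)) : x = H.code u := by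
  obtain ⟨D, hD⟩ := H.bounded
  refine H.eq_of_zero _ _ (le_antisymm ?_ (H.nonneg _ _))
  have ht := (tendsto_ratioProd H.ratio_pos H.ratio_lt_one u).mul_const D
  rw [zero_mul] at ht
  refine ge_of_tendsto' ht fun l => ?_
  obtain ⟨y, hy⟩ := hx l
  obtain ⟨z, hz⟩ := H.code_mem u l
  rw [← hy, ← hz, H.dist_wordMap]
  exact mul_le_mul_of_nonneg_left (hD _ _) (ratioProd_pos H.ratio_pos u l).le

/-- Pulling a point back through the piece containing it, again and again, reads off its address. -/
theorem code_surjective [Finite ι] (H : IsDustLike d h β) : Function.Surjective H.code := by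
  intro x
  choose a b hab using H.surj
  let z : ℕ → X := fun n => b^[n] x
  refine ⟨fun n => a (z n), (H.eq_code fun l => ⟨z l, ?_⟩).symm⟩
  induction l with
  | zero => rfl
  | succ l ih =>
    have : h (a (z l)) (z (l + 1)) = z l := by
      simp only [z, Function.iterate_succ_apply']
      exact hab _
    simpa [wordMap, this] using ih

theorem dist_code_le (H : IsDustLike d h β) {D : ℝ} (hD : ∀ x y, d x y ≤ D) {u v : ℕ → ι} {l : ℕ}
    (huv : ∀ i < l, u i = v i) : d (H.code u) (H.code v) ≤ ratioProd β u l * D := by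
  obtain ⟨y, hy⟩ := H.code_mem u l
  obtain ⟨z, hz⟩ := H.code_mem v l
  rw [← wordMap_congr h huv] at hz
  rw [← hy, ← hz, H.dist_wordMap]
  exact mul_le_mul_of_nonneg_left (hD _ _) (ratioProd_pos H.ratio_pos u l).le

theorem le_dist_code (H : IsDustLike d h β) {δ : ℝ}
    (hδ : ∀ i j, i ≠ j → ∀ x y, δ ≤ d (h i x) (h j y)) {u v : ℕ → ι} {l : ℕ}
    (huv : ∀ i < l, u i = v i) (hl : u l ≠ v l) :
    ratioProd β u l * δ ≤ d (H.code u) (H.code v) := by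
  -- One letter beyond the common prefix, so that the two points lie in different pieces.
  obtain ⟨y, hy⟩ := H.code_mem u (l + 1)
  obtain ⟨z, hz⟩ := H.code_mem v (l + 1)
  rw [← hy, ← hz, wordMap, wordMap, ← wordMap_congr h huv, Function.comp, Function.comp,
    H.dist_wordMap]
  exact mul_le_mul_of_nonneg_left (hδ _ _ hl _ _) (ratioProd_pos H.ratio_pos u l).le

theorem agree_of_dist_code_lt (H : IsDustLike d h β) {δ : ℝ} (hδ0 : 0 ≤ δ)
    (hδ : ∀ i j, i ≠ j → ∀ x y, δ ≤ d (h i x) (h j y)) {u v : ℕ → ι} {l : ℕ}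
    (huv : d (H.code u) (H.code v) < ratioProd β u l * δ) : ∀ i ≤ l, u i = v i := by
  intro i
  induction i using Nat.strong_induction_on with
  | _ i ih =>
    intro hi
    by_contra hne
    have := H.le_dist_code hδ (fun j hj => ih j hj (hj.le.trans hi)) hne
    have h2 := mul_le_mul_of_nonneg_right (ratioProd_antitone H.ratio_pos H.ratio_lt_one u hi) hδ0
    linarith

theorem code_injective (H : IsDustLike d h β) : Function.Injective H.code := by
  intro u v huv
  obtain ⟨δ, hδ0, hδ⟩ := H.separated
  funext l
  refine H.agree_of_dist_code_lt hδ0.le hδ (l := l) ?_ l le_rfl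
  rw [huv, H.self]
  exact mul_pos (ratioProd_pos H.ratio_pos u l) hδ0

theorem code_bijective [Finite ι] (H : IsDustLike d h β) : Function.Bijective H.code :=
  ⟨H.code_injective, H.code_surjective⟩

/-- Spaces that are dust-like for the same ratios are comparable through their codings. -/
theorem dist_code_le_mul {Y : Type*} {d' : Y → Y → ℝ} {h' : ι → Y → Y}
    (H : IsDustLike d h β) (H' : IsDustLike d' h' β) :
    ∃ C, 0 ≤ C ∧ ∀ u v, d' (H'.code u) (H'.code v) ≤ C * d (H.code u) (H.code v) := by
  obtain ⟨D, hD⟩ := H'.bounded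
  obtain ⟨δ, hδ0, hδ⟩ := H.separated
  refine ⟨max D 0 / δ, by positivity, fun u v => ?_⟩
  rcases eq_or_ne u v with rfl | huv
  · rw [H.self, H'.self, mul_zero]
  -- Both distances are comparable to the ratio product up to the first difference.
  · have h0 : ∀ i < PiNat.firstDiff u v, u i = v i := fun i hi => PiNat.apply_eq_of_lt_firstDiff hi
    have h1 := H'.dist_code_le (fun x y => (hD x y).trans (le_max_left D 0)) h0
    have h2 := H.le_dist_code hδ h0 (PiNat.apply_firstDiff_ne huv)
    calc _ ≤ _ := h1
      _ = max D 0 / δ * (ratioProd β u (PiNat.firstDiff u v) * δ) := by field_simp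
      _ ≤ _ := mul_le_mul_of_nonneg_left h2 (by positivity)

theorem exists_equiv [Finite ι] {Y : Type*} {d' : Y → Y → ℝ} {h' : ι → Y → Y}
    (H : IsDustLike d h β) (H' : IsDustLike d' h' β) :
    ∃ e : X ≃ Y, (∃ C, 0 ≤ C ∧ ∀ x y, d' (e x) (e y) ≤ C * d x y) ∧
      ∃ C, 0 ≤ C ∧ ∀ x y, d (e.symm x) (e.symm y) ≤ C * d' x y := by
  let E := Equiv.ofBijective _ H.code_bijective
  let E' := Equiv.ofBijective _ H'.code_bijective
  have hE : ∀ x, H.code (E.symm x) = x := E.apply_symm_apply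
  have hE' : ∀ x, H'.code (E'.symm x) = x := E'.apply_symm_apply
  obtain ⟨C, hC0, hC⟩ := H.dist_code_le_mul H'
  obtain ⟨C', hC0', hC'⟩ := H'.dist_code_le_mul H
  refine ⟨E.symm.trans E', ⟨C, hC0, fun x y => ?_⟩, C', hC0', fun x y => ?_⟩
  · have := hC (E.symm x) (E.symm y)
    rwa [hE, hE] at this
  · have := hC' (E'.symm x) (E'.symm y)
    rwa [hE', hE'] at this

end IsDustLike

/-! ### Self-similar sets with strong separation are dust-like. -/

/-- In a compact space, nested images of continuous maps have a common point. -/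
theorem exists_mem_range_wordMap {X ι : Type*} [TopologicalSpace X] [CompactSpace X] [T2Space X]
    [Nonempty X] {h : ι → X → X} (hc : ∀ i, Continuous (h i)) (u : ℕ → ι) :
    ∃ x, ∀ l, x ∈ Set.range (wordMap h u l) := by
  have hw : ∀ l, Continuous (wordMap h u l) := fun l => by
    induction l with
    | zero => exact continuous_id
    | succ l ih => exact ih.comp (hc _)
  obtain ⟨x, hx⟩ := IsCompact.nonempty_iInter_of_sequence_nonempty_isCompact_isClosed
    (fun l => Set.range (wordMap h u l)) (fun l => Set.range_comp_subset_range _ _)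
    (fun l => Set.range_nonempty _) (isCompact_range (hw 0)) (fun l => (isCompact_range (hw l)).isClosed)
  exact ⟨x, fun l => Set.mem_iInter.1 hx l⟩

/-- A self-similar set with the strong separation condition is dust-like. -/
theorem IsSelfSimilarSet.exists_isDustLike {n m : ℕ}
    {f : Fin m → EuclideanSpace ℝ (Fin n) → EuclideanSpace ℝ (Fin n)} {ρ : Fin m → ℝ}
    {K : Set (EuclideanSpace ℝ (Fin n))} (hK : IsSelfSimilarSet f ρ K)
    (hsep : StrongSeparation f K) :
    ∃ h : Fin m → K → K, IsDustLike (fun x y : K => dist x y) h ρ := by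
  have hmem : ∀ i, ∀ x ∈ K, f i x ∈ K := fun i x hx => by
    rw [hK.eq_iUnion]
    exact Set.mem_iUnion.2 ⟨i, x, hx, rfl⟩
  have hlip : ∀ i, Continuous (f i) := fun i =>
    (LipschitzWith.of_dist_le_mul (K := ⟨ρ i, (hK.ratio_pos i).le⟩) fun x y =>
      (hK.similarity i x y).le).continuous
  have : CompactSpace K := isCompact_iff_compactSpace.1 hK.isCompact
  have : Nonempty K := hK.nonempty.to_subtype
  refine ⟨fun i x => ⟨f i x, hmem i x x.2⟩, hK.ratio_pos, hK.ratio_lt_one, fun x => dist_self x,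
    fun x y => dist_nonneg, fun x y => eq_of_dist_eq_zero, ?_, fun i x y => hK.similarity i x y, ?_,
    ?_, exists_mem_range_wordMap fun i => ?_⟩
  · exact ⟨Metric.diam (Set.univ : Set K), fun x y =>
      Metric.dist_le_diam_of_mem isCompact_univ.isBounded trivial trivial⟩
  · rintro ⟨z, hz⟩
    rw [hK.eq_iUnion] at hz
    obtain ⟨i, x, hx, rfl⟩ := Set.mem_iUnion.1 hz
    exact ⟨i, ⟨x, hx⟩, rfl⟩
  · have hpair : ∀ p : Fin m × Fin m, ∃ δ > 0, p.1 ≠ p.2 →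
        ∀ x ∈ K, ∀ y ∈ K, δ ≤ dist (f p.1 x) (f p.2 y) := by
      rintro ⟨i, j⟩
      by_cases hij : i = j
      · exact ⟨1, one_pos, fun hne => (hne hij).elim⟩
      · obtain ⟨δ, hδ, hd⟩ := Metric.exists_pos_forall_lt_edist
          (hK.isCompact.image (hlip i)) (hK.isCompact.image (hlip j)).isClosed
          (Set.disjoint_iff_inter_eq_empty.2 (hsep i j hij))
        refine ⟨δ, NNReal.coe_pos.2 hδ, fun _ x hx y hy => ?_⟩
        have := hd _ ⟨x, hx, rfl⟩ _ ⟨y, hy, rfl⟩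
        rw [edist_nndist, ENNReal.coe_lt_coe] at this
        exact_mod_cast this.le
    choose δ hδ0 hδ using hpair
    rcases isEmpty_or_nonempty (Fin m) with hm | hm
    · exact ⟨1, one_pos, fun i => isEmptyElim i⟩
    · obtain ⟨p, hp⟩ := Finite.exists_min δ
      exact ⟨δ p, hδ0 p, fun i j hij x y =>
        (hp (i, j)).trans (hδ (i, j) hij x x.2 y y.2)⟩
  · exact Continuous.subtype_mk ((hlip i).comp continuous_subtype_val) _

/-! ### Bernoulli measures, Hausdorff dimension and Moran's equation. -/

open MeasureTheory Filter Topology in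
/-- The Bernoulli measure of a probability vector. -/
theorem exists_bernoulli {m : ℕ} (p : Fin m → ℝ) (hp : ∀ i, 0 ≤ p i) (hs : ∑ i, p i = 1) :
    ∃ μ : Measure (ℕ → Fin m), IsProbabilityMeasure μ ∧
      ∀ u l, μ (PiNat.cylinder u l) = ENNReal.ofReal (ratioProd p u l) := by
  let P : PMF (Fin m) := PMF.ofFintype (fun i => ENNReal.ofReal (p i)) (by
    rw [← ENNReal.ofReal_sum_of_nonneg fun i _ => hp i, hs, ENNReal.ofReal_one])
  refine ⟨Measure.infinitePi fun _ => P.toMeasure, inferInstance, fun u l => ?_⟩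
  have : PiNat.cylinder u l = Set.pi (Finset.range l : Set ℕ) fun i => {u i} := by
    rw [PiNat.cylinder_eq_pi]
  rw [this, Measure.infinitePi_pi _ fun i _ => measurableSet_singleton _, ratioProd,
    ENNReal.ofReal_prod_of_nonneg fun i _ => hp _]
  refine Finset.prod_congr rfl fun i _ => ?_
  rw [PMF.toMeasure_apply_singleton _ _ (measurableSet_singleton _)]
  rfl

section Dimension

open MeasureTheory Filter Topology

variable {X : Type*} [MetricSpace X] {m : ℕ} {h : Fin m → X → X} {β : Fin m → ℝ}

theorem IsDustLike.continuous_code (H : IsDustLike (fun x y : X => dist x y) h β) :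
    Continuous H.code := by
  obtain ⟨D, hD⟩ := H.bounded
  refine continuous_iff_continuousAt.2 fun u => Metric.tendsto_nhds.2 fun ε hε => ?_
  have ht := (tendsto_ratioProd H.ratio_pos H.ratio_lt_one u).mul_const D
  rw [zero_mul] at ht
  obtain ⟨l, hl⟩ := (ht.eventually (gt_mem_nhds hε)).exists
  filter_upwards [(PiNat.isOpen_cylinder _ u l).mem_nhds (PiNat.self_mem_cylinder u l)] with v hv
  rw [dist_comm]
  exact (H.dist_code_le hD fun i hi => (hv i hi).symm).trans_lt hl

/-- The cylinders of level `n` form covers of vanishing mesh; their diameters to the power `s` sum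
to at most `D ^ s`, because the weights of words sum to `(∑ i, β i ^ s) ^ n = 1`. -/
theorem IsDustLike.dimH_le [MeasurableSpace X] [BorelSpace X]
    (H : IsDustLike (fun x y : X => dist x y) h β) {s : NNReal}
    (hs : ∑ i, β i ^ (s : ℝ) = 1) : dimH (Set.univ : Set X) ≤ s := by
  obtain ⟨D', hD'⟩ := H.bounded
  obtain ⟨D, hD, hD0⟩ : ∃ D, (∀ x y : X, dist x y ≤ D) ∧ 0 ≤ D :=
    ⟨max D' 0, fun x y => (hD' x y).trans (le_max_left _ _), le_max_right _ _⟩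
  obtain ⟨c, hc0, hc1, hc⟩ := exists_ratio_bound H.ratio_pos H.ratio_lt_one
  have hw : ∀ n (w : Fin n → Fin m), 0 ≤ ∏ i, β (w i) := fun n w =>
    Finset.prod_nonneg fun i _ => (H.ratio_pos _).le
  have hdiam : ∀ n (w : Fin n → Fin m),
      Metric.ediam (H.code '' {u | ∀ i : Fin n, u i = w i}) ≤ ENNReal.ofReal ((∏ i, β (w i)) * D) := by
    refine fun n w => Metric.ediam_le ?_
    rintro _ ⟨u, hu, rfl⟩ _ ⟨v, hv, rfl⟩
    have h1 : ratioProd β u n = ∏ i, β (w i) := by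
      rw [ratioProd, Finset.prod_range]
      exact Finset.prod_congr rfl fun i _ => by rw [hu i]
    rw [edist_dist, ← h1]
    exact ENNReal.ofReal_le_ofReal (H.dist_code_le hD fun i hi => (hu ⟨i, hi⟩).trans (hv ⟨i, hi⟩).symm)
  have hsum : ∀ n, ∑ w : Fin n → Fin m,
      Metric.ediam (H.code '' {u | ∀ i : Fin n, u i = w i}) ^ (s : ℝ) ≤ ENNReal.ofReal (D ^ (s : ℝ)) := by
    intro n
    calc _ ≤ ∑ w : Fin n → Fin m, ENNReal.ofReal ((∏ i, β (w i) ^ (s : ℝ)) * D ^ (s : ℝ)) := by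
          refine Finset.sum_le_sum fun w _ => ?_
          rw [Real.finsetProd_rpow _ _ (fun _ _ => (H.ratio_pos _).le),
            ← Real.mul_rpow (hw n w) hD0,
            ← ENNReal.ofReal_rpow_of_nonneg (mul_nonneg (hw n w) hD0) s.coe_nonneg]
          exact ENNReal.rpow_le_rpow (hdiam n w) s.coe_nonneg
      _ = ENNReal.ofReal (D ^ (s : ℝ)) := by
          rw [← ENNReal.ofReal_sum_of_nonneg fun w _ => mul_nonneg (Finset.prod_nonneg fun i _ =>
            Real.rpow_nonneg (H.ratio_pos _).le _) (Real.rpow_nonneg hD0 _), ← Finset.sum_mul]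
          have := Finset.prod_univ_sum (fun _ : Fin n => (Finset.univ : Finset (Fin m)))
            (fun _ i => β i ^ (s : ℝ))
          rw [Fintype.piFinset_univ] at this
          rw [← this, hs]
          simp
  refine dimH_le_of_hausdorffMeasure_ne_top (ne_top_of_le_ne_top ENNReal.ofReal_ne_top
    ((Measure.hausdorffMeasure_le_liminf_sum (s : ℝ) Set.univ (l := atTop)
      (fun n => ENNReal.ofReal (c ^ n * D)) ?_
      (fun n (w : Fin n → Fin m) => H.code '' {u | ∀ i : Fin n, u i = w i}) ?_ ?_).trans
    ((liminf_le_liminf (Eventually.of_forall hsum)).trans (liminf_const _).le)))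
  · have := (tendsto_pow_atTop_nhds_zero_of_lt_one hc0 hc1).mul_const D
    rw [zero_mul] at this
    simpa using ENNReal.tendsto_ofReal this
  · refine Eventually.of_forall fun n w => ?_
    rcases Set.eq_empty_or_nonempty {u : ℕ → Fin m | ∀ i : Fin n, u i = w i} with he | ⟨u, hu⟩
    · simp [he]
    · refine (hdiam n w).trans (ENNReal.ofReal_le_ofReal (mul_le_mul_of_nonneg_right ?_ hD0))
      refine le_trans (le_of_eq ?_) (hc u n)
      rw [ratioProd, Finset.prod_range]
      exact Finset.prod_congr rfl fun i _ => by rw [hu i]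
  · refine Eventually.of_forall fun n x _ => ?_
    obtain ⟨u, rfl⟩ := H.code_surjective x
    exact Set.mem_iUnion.2 ⟨fun i => u i, u, fun i => rfl, rfl⟩

/-- Mass distribution principle for the Bernoulli measure with weights `β i ^ s`: by separation, a
set of small diameter lies in one cylinder of comparable size. -/
theorem IsDustLike.le_dimH [MeasurableSpace X] [BorelSpace X]
    (H : IsDustLike (fun x y : X => dist x y) h β) {s : NNReal} (hs0 : 0 < s)
    (hs : ∑ i, β i ^ (s : ℝ) = 1) : s ≤ dimH (Set.univ : Set X) := by
  obtain ⟨D, hD⟩ := H.bounded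
  obtain ⟨δ, hδ0, hδ⟩ := H.separated
  have hs0' : (0 : ℝ) < s := hs0
  obtain ⟨μ, hμ, hcyl⟩ := exists_bernoulli (fun i => β i ^ (s : ℝ))
    (fun i => Real.rpow_nonneg (H.ratio_pos i).le _) hs
  have hmeas : Measurable H.code := H.continuous_code.measurable
  have key : ∀ E : Set X, ENNReal.ofReal (δ ^ (s : ℝ)) * μ.map H.code E ≤ Metric.ediam E ^ (s : ℝ) := by
    intro E
    have hbdd : Bornology.IsBounded E := (Metric.isBounded_iff).2 ⟨D, fun x _ y _ => hD x y⟩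
    have hfin : Metric.ediam E ≠ ⊤ := hbdd.ediam_ne_top
    rcases E.eq_empty_or_nonempty with rfl | ⟨x, hx⟩
    · simp
    obtain ⟨u, rfl⟩ := H.code_surjective x
    have hle : ∀ l, (∀ i < l, Metric.diam E < ratioProd β u i * δ) →
        μ.map H.code E ≤ ENNReal.ofReal (ratioProd β u l ^ (s : ℝ)) := by
      intro l hl
      rw [← ratioProd_rpow H.ratio_pos, ← hcyl]
      -- The closure is measurable and has the same diameter.
      refine (measure_mono subset_closure).trans ?_
      rw [Measure.map_apply hmeas isClosed_closure.measurableSet]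
      refine measure_mono fun v hv i hi => ?_
      refine (H.agree_of_dist_code_lt hδ0.le hδ (l := i) (lt_of_le_of_lt ?_ (hl i hi)) i le_rfl).symm
      rw [← Metric.diam_closure]
      exact Metric.dist_le_diam_of_mem hbdd.closure (subset_closure hx) hv
    by_cases hex : ∃ l, ratioProd β u l * δ ≤ Metric.diam E
    · classical
      have h1 := hle (Nat.find hex) fun i hi => not_le.1 (Nat.find_min hex hi)
      have h2 := Nat.find_spec hex
      calc _ ≤ ENNReal.ofReal (δ ^ (s : ℝ)) * ENNReal.ofReal (ratioProd β u (Nat.find hex) ^ (s : ℝ)) := by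
            gcongr
        _ = ENNReal.ofReal ((ratioProd β u (Nat.find hex) * δ) ^ (s : ℝ)) := by
          rw [← ENNReal.ofReal_mul (Real.rpow_nonneg hδ0.le _), mul_comm,
            ← Real.mul_rpow (ratioProd_pos H.ratio_pos _ _).le hδ0.le]
        _ ≤ ENNReal.ofReal (Metric.diam E ^ (s : ℝ)) := by
          refine ENNReal.ofReal_le_ofReal (Real.rpow_le_rpow ?_ h2 s.coe_nonneg)
          exact mul_nonneg (ratioProd_pos H.ratio_pos _ _).le hδ0.le
        _ = _ := by
          rw [← ENNReal.ofReal_rpow_of_nonneg Metric.diam_nonneg s.coe_nonneg, Metric.diam,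
            ENNReal.ofReal_toReal hfin]
    -- Here `E` is inside cylinders of every length around `u`, hence null since `s > 0`.
    · push Not at hex
      have h0 : μ.map H.code E = 0 := by
        have ht := (tendsto_ratioProd H.ratio_pos H.ratio_lt_one u).rpow_const
          (p := (s : ℝ)) (Or.inr s.coe_nonneg)
        rw [Real.zero_rpow hs0'.ne'] at ht
        have ht' := ENNReal.tendsto_ofReal ht
        rw [ENNReal.ofReal_zero] at ht'
        exact le_antisymm (ge_of_tendsto' ht' fun l => hle l fun i _ => hex i) zero_le
      rw [h0, mul_zero]
      exact zero_le
  have hH := Measure.le_hausdorffMeasure (s : ℝ) (ENNReal.ofReal (δ ^ (s : ℝ)) • μ.map H.code)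
    1 one_pos fun E _ => by simpa using key E
  refine le_dimH_of_hausdorffMeasure_ne_zero (ne_of_gt (lt_of_lt_of_le ?_ (hH Set.univ)))
  have : IsProbabilityMeasure (μ.map H.code) := Measure.isProbabilityMeasure_map hmeas.aemeasurable
  simp only [Measure.smul_apply, measure_univ, smul_eq_mul, mul_one, ENNReal.ofReal_pos]
  exact Real.rpow_pos_of_pos hδ0 _

theorem IsDustLike.dimH_eq (H : IsDustLike (fun x y : X => dist x y) h β) {s : NNReal}
    (hs : ∑ i, β i ^ (s : ℝ) = 1) : dimH (Set.univ : Set X) = s := by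
  borelize X
  refine le_antisymm (H.dimH_le hs) ?_
  rcases eq_or_lt_of_le (zero_le : 0 ≤ s) with rfl | h0
  · simp
  · exact H.le_dimH h0 hs

end Dimension

theorem exists_sum_rpow_eq_one {m : ℕ} [NeZero m] {β : Fin m → ℝ} (hβ : ∀ i, 0 < β i)
    (hβ' : ∀ i, β i < 1) : ∃ s : NNReal, ∑ i, β i ^ (s : ℝ) = 1 := by
  have hcont : Continuous fun s : ℝ => ∑ i, β i ^ s :=
    continuous_finsetSum _ fun i _ => Real.continuous_const_rpow (hβ i).ne'
  have hlim : Filter.Tendsto (fun s : ℝ => ∑ i, β i ^ s) Filter.atTop (nhds 0) := by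
    simpa using tendsto_finsetSum (Finset.univ : Finset (Fin m)) fun i _ =>
      tendsto_rpow_atTop_of_base_lt_one (β i) (by linarith [hβ i]) (hβ' i)
  obtain ⟨T, hT1, hT0⟩ := ((hlim.eventually (gt_mem_nhds one_pos)).and
    (Filter.eventually_ge_atTop 0)).exists
  have h0 : (1 : ℝ) ≤ ∑ i, β i ^ (0 : ℝ) := by
    simpa using Nat.one_le_iff_ne_zero.2 (NeZero.ne m)
  obtain ⟨s, hs, hs1⟩ := intermediate_value_Icc' hT0 hcont.continuousOn ⟨hT1.le, h0⟩
  exact ⟨⟨s, hs.1⟩, hs1⟩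

/-- The dimension of a self-similar set with strong separation solves Moran's equation. -/
theorem IsSelfSimilarSet.exists_moran {n m : ℕ}
    {f : Fin m → EuclideanSpace ℝ (Fin n) → EuclideanSpace ℝ (Fin n)} {ρ : Fin m → ℝ}
    {K : Set (EuclideanSpace ℝ (Fin n))} (hK : IsSelfSimilarSet f ρ K)
    (hsep : StrongSeparation f K) : ∃ s : NNReal, dimH K = s ∧ ∑ i, ρ i ^ (s : ℝ) = 1 := by
  obtain ⟨h, H⟩ := hK.exists_isDustLike hsep
  have : NeZero m := ⟨by
    rintro rfl
    obtain ⟨x, hx⟩ := hK.nonempty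
    rw [hK.eq_iUnion] at hx
    simp at hx⟩
  obtain ⟨s, hs⟩ := exists_sum_rpow_eq_one hK.ratio_pos hK.ratio_lt_one
  have hK' := (isometry_subtype_coe (s := K)).dimH_image Set.univ
  rw [Set.image_univ, Subtype.range_coe, H.dimH_eq hs] at hK'
  exact ⟨s, hK', hs⟩

/-! ### The symbolic model and complete prefix codes. -/

section Kraft

variable {a : ℕ} {ρ : ℝ}

open Classical in
/-- The ultrametric of ratio `ρ` on infinite words. -/
noncomputable def addressDist (ρ : ℝ) (x y : ℕ → Fin a) : ℝ :=
  if x = y then 0 else ρ ^ PiNat.firstDiff x y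

/-- The infinite word `x` preceded by the letter `i`. -/
def consAddress (i : Fin a) (x : ℕ → Fin a) : ℕ → Fin a
  | 0 => i
  | n + 1 => x n

theorem addressDist_self (x : ℕ → Fin a) : addressDist ρ x x = 0 := by simp [addressDist]

theorem addressDist_eq {x y : ℕ → Fin a} {l : ℕ} (hxy : ∀ i < l, x i = y i) (hl : x l ≠ y l) :
    addressDist ρ x y = ρ ^ l := by
  have hne : x ≠ y := fun h => hl (congrFun h l)
  have : PiNat.firstDiff x y = l := by
    refine le_antisymm (not_lt.1 fun h => hl (PiNat.apply_eq_of_lt_firstDiff h)) (not_lt.1 fun h => ?_)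
    exact PiNat.apply_firstDiff_ne hne (hxy _ h)
  rw [addressDist, if_neg hne, this]

theorem addressDist_nonneg (hρ : 0 < ρ) (x y : ℕ → Fin a) : 0 ≤ addressDist ρ x y := by
  unfold addressDist
  split_ifs <;> positivity

theorem addressDist_le_one (hρ : 0 < ρ) (hρ' : ρ < 1) (x y : ℕ → Fin a) : addressDist ρ x y ≤ 1 := by
  unfold addressDist
  split_ifs
  · exact zero_le_one
  · exact pow_le_one₀ hρ.le hρ'.le

theorem eq_of_addressDist_eq_zero (hρ : 0 < ρ) {x y : ℕ → Fin a} (h : addressDist ρ x y = 0) :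
    x = y := by
  by_contra hne
  rw [addressDist, if_neg hne] at h
  exact (pow_pos hρ _).ne' h

theorem addressDist_consAddress (i : Fin a) (x y : ℕ → Fin a) :
    addressDist ρ (consAddress i x) (consAddress i y) = ρ * addressDist ρ x y := by
  rcases eq_or_ne x y with rfl | hne
  · simp [addressDist_self]
  · have hxy : addressDist ρ x y = ρ ^ PiNat.firstDiff x y := if_neg hne
    rw [hxy, ← pow_succ']
    refine addressDist_eq (fun j hj => ?_) (PiNat.apply_firstDiff_ne hne)
    cases j with
    | zero => rfl
    | succ j =>
      have hj' : j < PiNat.firstDiff x y := Nat.lt_of_succ_lt_succ hj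
      have hxj : x j = y j := PiNat.apply_eq_of_lt_firstDiff hj'
      exact hxj

theorem addressDist_consAddress_of_ne {i j : Fin a} (hij : i ≠ j) (x y : ℕ → Fin a) :
    addressDist ρ (consAddress i x) (consAddress j y) = 1 := by
  simpa using addressDist_eq (ρ := ρ) (l := 0) (x := consAddress i x) (y := consAddress j y)
    (by simp) hij

theorem continuous_consAddress (i : Fin a) : Continuous (consAddress i) := by
  refine continuous_pi fun n => ?_
  cases n with
  | zero => exact continuous_const
  | succ n => exact continuous_apply n

theorem exists_consAddress (z : ℕ → Fin a) : ∃ i x, consAddress i x = z :=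
  ⟨z 0, fun n => z (n + 1), by funext n; cases n <;> rfl⟩

/-- In a Kraft equality, the number of longest words is a positive multiple of the size of the
alphabet, unless there is only the empty word. -/
theorem exists_longest_words {ι : Type} [Fintype ι] (ha : 2 ≤ a) (p : ι → ℕ)
    (hp : ∑ i, (1 / (a : ℝ)) ^ p i = 1) {P : ℕ} (hP : ∀ i, p i ≤ P + 1) {i₀ : ι}
    (hi₀ : p i₀ = P + 1) : ∃ T : Finset ι, T.card = a ∧ ∀ i ∈ T, p i = P + 1 := by
  classical
  have ha0 : (a : ℝ) ≠ 0 := by positivity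
  -- The Kraft equality cleared of denominators; modulo `a` only the longest words survive.
  have hsum : ∑ i, a ^ (P + 1 - p i) = a ^ (P + 1) := by
    have : (∑ i, (a : ℝ) ^ (P + 1 - p i)) = (a : ℝ) ^ (P + 1) := by
      calc _ = ∑ i, (a : ℝ) ^ (P + 1) * (1 / (a : ℝ)) ^ p i := by
            refine Finset.sum_congr rfl fun i _ => ?_
            rw [pow_sub₀ _ ha0 (hP i), one_div, inv_pow]
        _ = _ := by rw [← Finset.mul_sum, hp, mul_one]
    exact_mod_cast this
  let S : Finset ι := Finset.univ.filter fun i => p i = P + 1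
  have hdvd : a ∣ S.card := by
    have h1 := Finset.sum_filter_add_sum_filter_not Finset.univ (fun i => p i = P + 1)
      fun i => a ^ (P + 1 - p i)
    have h2 : ∑ i ∈ Finset.univ.filter (fun i => p i = P + 1), a ^ (P + 1 - p i) = S.card := by
      rw [Finset.card_eq_sum_ones]
      exact Finset.sum_congr rfl fun i hi => by simp [(Finset.mem_filter.1 hi).2]
    have h3 : a ∣ ∑ i ∈ Finset.univ.filter (fun i => ¬ p i = P + 1), a ^ (P + 1 - p i) :=
      Finset.dvd_sum fun i hi => dvd_pow_self _ (by
        have := hP i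
        have := (Finset.mem_filter.1 hi).2
        omega)
    rw [hsum, h2] at h1
    exact (Nat.dvd_add_left h3).1 (h1 ▸ dvd_pow_self a P.succ_ne_zero)
  have hle : a ≤ S.card := Nat.le_of_dvd (Finset.card_pos.2 ⟨i₀, by simp [S, hi₀]⟩) hdvd
  obtain ⟨T, hTS, hT⟩ := Finset.exists_subset_card_eq hle
  exact ⟨T, hT, fun i hi => (Finset.mem_filter.1 (hTS hi)).2⟩

/-- Kraft: lengths satisfying the Kraft equality are those of a complete prefix code, here given by
the maps that put a code word in front of an infinite word. -/
theorem exists_prefix_maps (ha : 2 ≤ a) (hρ : 0 < ρ) (N : ℕ) :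
    ∀ (ι : Type) [Fintype ι], Fintype.card ι = N → ∀ p : ι → ℕ, ∑ i, (1 / (a : ℝ)) ^ p i = 1 →
    ∃ h : ι → (ℕ → Fin a) → (ℕ → Fin a), (∀ i, Continuous (h i)) ∧
      (∀ i x y, addressDist ρ (h i x) (h i y) = ρ ^ p i * addressDist ρ x y) ∧
      (∀ z, ∃ i x, h i x = z) ∧
      ∃ δ > 0, ∀ i j, i ≠ j → ∀ x y, δ ≤ addressDist ρ (h i x) (h j y) := by
  classical
  induction N using Nat.strong_induction_on with
  | _ N ih =>
  intro ι _ hN p hp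
  have : Nonempty ι := by
    by_contra hne
    have := not_nonempty_iff.1 hne
    simp at hp
  obtain ⟨i₀, hi₀⟩ := Finite.exists_max p
  rcases Nat.eq_zero_or_pos (p i₀) with h0 | hpos
  · have hp0 : ∀ i, p i = 0 := fun i => Nat.le_zero.1 (h0 ▸ hi₀ i)
    have hcard : Fintype.card ι = 1 := by
      simp only [hp0, pow_zero, Finset.sum_const, nsmul_eq_mul, mul_one] at hp
      exact_mod_cast hp
    have hsub : Subsingleton ι := Fintype.card_le_one_iff_subsingleton.1 hcard.le
    exact ⟨fun _ => id, fun _ => continuous_id, fun i x y => by simp [hp0], fun z => ⟨i₀, z, rfl⟩,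
      1, one_pos, fun i j hij => (hij (Subsingleton.elim i j)).elim⟩
  obtain ⟨P, hP⟩ : ∃ P, p i₀ = P + 1 := ⟨p i₀ - 1, by omega⟩
  obtain ⟨T, hT, hTp⟩ := exists_longest_words ha p hp (fun i => hP ▸ hi₀ i) hP
  let e : T ≃ Fin a := T.equivFinOfCardEq hT
  -- Replace `a` longest words by one parent word of length `P`, indexed by `none`; the Kraft sum is
  -- unchanged and there are fewer words.
  have hcard : Fintype.card (Option {j // j ∉ T}) < N := by
    have h1 : Fintype.card {j // j ∉ T} = Fintype.card ι - T.card := by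
      rw [Fintype.card_subtype_compl, Fintype.card_coe]
    have h2 := T.card_le_univ
    rw [Fintype.card_option, h1]
    omega
  have hsum : ∑ i : Option {j // j ∉ T}, (1 / (a : ℝ)) ^ (i.elim P fun j => p j) = 1 := by
    have h1 := Finset.sum_add_sum_compl T fun i => (1 / (a : ℝ)) ^ p i
    have h2 : ∑ i ∈ T, (1 / (a : ℝ)) ^ p i = (1 / (a : ℝ)) ^ P := by
      rw [Finset.sum_congr rfl fun i hi => by rw [hTp i hi], Finset.sum_const, hT, nsmul_eq_mul]
      have : (a : ℝ) ≠ 0 := by positivity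
      rw [pow_succ]
      field_simp
    have h3 : ∑ i ∈ Tᶜ, (1 / (a : ℝ)) ^ p i = ∑ i : {j // j ∉ T}, (1 / (a : ℝ)) ^ p i :=
      Finset.sum_subtype _ (by simp) _
    rw [Fintype.sum_option]
    simp only [Option.elim]
    rw [← h3, ← h2, h1, hp]
  obtain ⟨h', hc, hscale, hsurj, δ, hδ0, hδ⟩ := ih _ hcard _ rfl _ hsum
  let h : ι → (ℕ → Fin a) → (ℕ → Fin a) := fun i =>
    if hi : i ∈ T then h' none ∘ consAddress (e ⟨i, hi⟩) else h' (some ⟨i, hi⟩)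
  have hin : ∀ i (hi : i ∈ T), h i = h' none ∘ consAddress (e ⟨i, hi⟩) := fun i hi => dif_pos hi
  have hout : ∀ i (hi : i ∉ T), h i = h' (some ⟨i, hi⟩) := fun i hi => dif_neg hi
  -- Two children of the merged word are at distance exactly `ρ ^ P`.
  refine ⟨h, fun i => ?_, fun i x y => ?_, fun z => ?_, min δ (ρ ^ P), lt_min hδ0 (pow_pos hρ P),
    fun i j hij x y => ?_⟩
  · by_cases hi : i ∈ T
    · rw [hin i hi]
      exact (hc none).comp (continuous_consAddress _)
    · rw [hout i hi]
      exact hc _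
  · by_cases hi : i ∈ T
    · rw [hin i hi, Function.comp, Function.comp, hscale, addressDist_consAddress, hTp i hi]
      simp only [Option.elim]
      ring
    · rw [hout i hi, hscale]
      rfl
  · obtain ⟨i, x, rfl⟩ := hsurj z
    cases i with
    | none =>
      obtain ⟨j, y, rfl⟩ := exists_consAddress x
      refine ⟨e.symm j, y, ?_⟩
      rw [hin _ (e.symm j).2]
      simp
    | some i => exact ⟨i, x, by rw [hout i i.2]⟩
  · by_cases hi : i ∈ T <;> by_cases hj : j ∈ T
    · have hne : e ⟨i, hi⟩ ≠ e ⟨j, hj⟩ := fun he => hij (congrArg Subtype.val (e.injective he))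
      rw [hin i hi, hin j hj, Function.comp, Function.comp, hscale,
        addressDist_consAddress_of_ne hne, mul_one]
      exact min_le_right _ _
    · rw [hin i hi, hout j hj]
      exact (min_le_left _ _).trans (hδ _ _ (by simp) _ _)
    · rw [hout i hi, hin j hj]
      exact (min_le_left _ _).trans (hδ _ _ (by simp) _ _)
    · rw [hout i hi, hout j hj]
      exact (min_le_left _ _).trans (hδ _ _ (by simpa using hij) _ _)

theorem exists_isDustLike_addressDist (ha : 2 ≤ a) (hρ : 0 < ρ) (hρ' : ρ < 1) {m : ℕ}
    {p : Fin m → ℕ} (hp0 : ∀ i, 0 < p i) (hp : ∑ i, (1 / (a : ℝ)) ^ p i = 1) :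
    ∃ h : Fin m → (ℕ → Fin a) → (ℕ → Fin a),
      IsDustLike (addressDist ρ) h fun i => ρ ^ p i := by
  obtain ⟨h, hc, hscale, hsurj, hsep⟩ := exists_prefix_maps ha hρ _ (Fin m) rfl p hp
  have : NeZero a := ⟨by omega⟩
  exact ⟨h, fun i => pow_pos hρ _, fun i => pow_lt_one₀ hρ.le hρ' (hp0 i).ne', addressDist_self,
    addressDist_nonneg hρ, fun x y => eq_of_addressDist_eq_zero hρ,
    ⟨1, addressDist_le_one hρ hρ'⟩, hscale, hsurj, hsep, exists_mem_range_wordMap hc⟩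

end Kraft

/-! ### Integer counts in nearly extremal cylinders. -/

section Counting

open MeasureTheory

variable {q m : ℕ}

/-- The uniform Bernoulli measure of a set that depends on the first `n` letters only. -/
theorem measure_eq_natCast_mul [NeZero q] {μ : Measure (ℕ → Fin q)} [IsProbabilityMeasure μ]
    (hμ : ∀ u l, μ (PiNat.cylinder u l) = ENNReal.ofReal (ratioProd (fun _ => 1 / (q : ℝ)) u l))
    {S : Set (ℕ → Fin q)} {n : ℕ} (hS : ∀ u ∈ S, ∀ v, (∀ i < n, u i = v i) → v ∈ S) :
    MeasurableSet S ∧ ∃ M : ℕ, μ.real S = M * (1 / (q : ℝ)) ^ n ∧ (S.Nonempty → 0 < M) := by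
  classical
  -- The padding by `0` is immaterial: membership in `S` only sees the first `n` letters.
  let ext : (Fin n → Fin q) → ℕ → Fin q := fun w i => if hi : i < n then w ⟨i, hi⟩ else 0
  have hext : ∀ (w : Fin n → Fin q) (i : Fin n), ext w i = w i := fun w i => dif_pos i.2
  have hmeas : ∀ w, MeasurableSet (PiNat.cylinder (ext w) n) := fun w =>
    (PiNat.isOpen_cylinder _ _ _).measurableSet
  let T : Finset (Fin n → Fin q) := Finset.univ.filter fun w => ext w ∈ S
  have hagree : ∀ u : ℕ → Fin q, ∀ i < n, ext (fun i => u i) i = u i := fun u i hi =>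
    hext (fun i => u i) ⟨i, hi⟩
  have hT : ∀ u ∈ S, (fun i : Fin n => u i) ∈ T := fun u hu =>
    Finset.mem_filter.2 ⟨Finset.mem_univ _, hS u hu _ fun i hi => (hagree u i hi).symm⟩
  have hunion : S = ⋃ w ∈ T, PiNat.cylinder (ext w) n := by
    ext u
    simp only [Set.mem_iUnion, exists_prop]
    refine ⟨fun hu => ⟨_, hT u hu, fun i hi => (hagree u i hi).symm⟩, ?_⟩
    rintro ⟨w, hw, hu⟩
    exact hS _ (Finset.mem_filter.1 hw).2 _ fun i hi => (hu i hi).symm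
  have hdisj : (T : Set (Fin n → Fin q)).PairwiseDisjoint fun w => PiNat.cylinder (ext w) n := by
    intro w _ w' _ hne
    refine Set.disjoint_left.2 fun u hu hu' => hne (funext fun i => ?_)
    rw [← hext w, ← hext w', ← hu i i.2, ← hu' i i.2]
  refine ⟨hunion ▸ Finset.measurableSet_biUnion _ fun w _ => hmeas w, T.card, ?_, fun ⟨u, hu⟩ =>
    Finset.card_pos.2 ⟨_, hT u hu⟩⟩
  have hr : ∀ w, μ.real (PiNat.cylinder (ext w) n) = (1 / (q : ℝ)) ^ n := fun w => by
    rw [measureReal_def, hμ, ENNReal.toReal_ofReal, ratioProd, Finset.prod_const,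
      Finset.card_range]
    exact Finset.prod_nonneg fun _ _ => by positivity
  rw [hunion, measureReal_biUnion_finset hdisj fun w _ => hmeas w, Finset.sum_congr rfl fun w _ => hr w,
    Finset.sum_const, nsmul_eq_mul]

/-- On a finite set the least value of `|φ|` is attained, so it cannot be arbitrarily small without
vanishing. -/
theorem exists_zero_of_forall_abs_le {α : Type*} (T : Finset α) (φ : α → ℝ) {ε₀ c : ℝ}
    (hε₀ : 0 < ε₀) (hc : 0 < c) (h : ∀ ε > 0, ε ≤ ε₀ → ∃ x ∈ T, |φ x| ≤ ε * c) :
    ∃ x ∈ T, φ x = 0 := by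
  obtain ⟨x₀, hx₀, -⟩ := h ε₀ hε₀ le_rfl
  obtain ⟨y, hy, hmin⟩ := T.exists_min_image (fun x => |φ x|) ⟨x₀, hx₀⟩
  refine ⟨y, hy, ?_⟩
  by_contra hne
  have hpos : 0 < |φ y| := abs_pos.2 hne
  obtain ⟨x, hx, hxle⟩ := h (min ε₀ (|φ y| / (2 * c))) (by positivity) (min_le_left _ _)
  have h1 : min ε₀ (|φ y| / (2 * c)) * c ≤ |φ y| / 2 := by
    calc _ ≤ |φ y| / (2 * c) * c := by gcongr; exact min_le_right _ _
      _ = |φ y| / 2 := by field_simp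
  linarith [hmin x hx]

/-- The arithmetic consequence for two nearly extremal nested cylinders. -/
theorem nested_counts {Q h₀ ε C w B : ℝ} {K D M M' n n' : ℕ} (hQ : 2 ≤ Q) (hh₀ : 0 < h₀)
    (hε : ε ≤ h₀ * B) (hC : 1 ≤ C) (hB : 0 < B) (hB1 : B ≤ 1)
    (hK : 2 * h₀ * (C * Q) ≤ K) (hD : Q / B ≤ D) (hw : 0 < w)
    (h1 : C * (1 / Q) ^ n < w) (h2 : w ≤ C * Q * (1 / Q) ^ n)
    (h1' : C * (1 / Q) ^ n' < w * B) (h2' : w * B ≤ C * Q * (1 / Q) ^ n')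
    (hP : h₀ * w ≤ M * (1 / Q) ^ n) (hP2 : M * (1 / Q) ^ n ≤ h₀ * w + ε * w)
    (hP' : h₀ * (w * B) ≤ M' * (1 / Q) ^ n') (hP2' : M' * (1 / Q) ^ n' ≤ h₀ * (w * B) + ε * w) :
    M ≤ K ∧ M' ≤ K ∧ ∃ d ≤ D, |M * B - M' * (1 / Q) ^ d| ≤ ε * (C * Q) := by
  have hQ0 : 0 < Q := by linarith
  have hR0 : 0 < 1 / Q := by positivity
  have hR1 : 1 / Q < 1 := by rw [div_lt_one hQ0]; linarith
  have hpn : 0 < (1 / Q) ^ n := pow_pos hR0 n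
  have hpn' : 0 < (1 / Q) ^ n' := pow_pos hR0 n'
  have hCQ : 0 < C * Q := by positivity
  -- The error is at most the main term of even the smaller cylinder, whence the factor 2 in the
  -- bound on `K`.
  have hεh : ε * w ≤ h₀ * w * B := by nlinarith
  refine ⟨?_, ?_, ?_⟩
  · have : (M : ℝ) ≤ K := by
      refine le_trans (le_of_mul_le_mul_right ?_ hpn) hK
      have h3 : h₀ * w * B ≤ h₀ * w := mul_le_of_le_one_right (by positivity) hB1
      have h4 : h₀ * w ≤ h₀ * (C * Q * (1 / Q) ^ n) := by gcongr
      linarith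
    exact_mod_cast this
  · have : (M' : ℝ) ≤ K := by
      refine le_trans (le_of_mul_le_mul_right ?_ hpn') hK
      have h4 : h₀ * (w * B) ≤ h₀ * (C * Q * (1 / Q) ^ n') := by gcongr
      linarith
    exact_mod_cast this
  · have hnn : n ≤ n' := by
      by_contra hlt
      have h3 : (1 / Q) ^ n ≤ (1 / Q) ^ (n' + 1) := pow_le_pow_of_le_one hR0.le hR1.le (by omega)
      have h4 : C * Q * (1 / Q) ^ n ≤ C * (1 / Q) ^ n' := by
        calc _ ≤ C * Q * (1 / Q) ^ (n' + 1) := by gcongr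
          _ = _ := by rw [pow_succ]; field_simp
      have h5 : w * B ≤ w := mul_le_of_le_one_right hw.le hB1
      linarith
    obtain ⟨d, rfl⟩ := Nat.exists_eq_add_of_le hnn
    rw [pow_add] at h1' h2' hP' hP2'
    refine ⟨d, ?_, ?_⟩
    · have h3 : C * (1 / Q) ^ n * B ≤ C * Q * ((1 / Q) ^ n * (1 / Q) ^ d) :=
        (mul_le_mul_of_nonneg_right h1.le hB.le).trans h2'
      have h4 : B ≤ Q * (1 / Q) ^ d := by
        refine le_of_mul_le_mul_left ?_ (show 0 < C * (1 / Q) ^ n by positivity)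
        linarith
      have h5 : Q ^ d ≤ Q / B := by
        rw [le_div_iff₀ hB]
        calc Q ^ d * B ≤ Q ^ d * (Q * (1 / Q) ^ d) := by gcongr
          _ = Q := by rw [one_div, inv_pow]; field_simp
      have h6 : ((2 : ℕ) : ℝ) ^ d ≤ D := by
        calc ((2 : ℕ) : ℝ) ^ d ≤ Q ^ d := by push_cast; gcongr
          _ ≤ D := h5.trans hD
      have h7 : 2 ^ d ≤ D := by exact_mod_cast h6
      exact d.lt_two_pow_self.le.trans h7
    · have hε0 : 0 ≤ ε * w := by
        have : 0 ≤ ε * w := by linarith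
        exact this
      have hle : ε * w ≤ ε * (C * Q * (1 / Q) ^ n) :=
        mul_le_mul_of_nonneg_left h2 (nonneg_of_mul_nonneg_left hε0 hw)
      have hεB : ε * w * B ≤ ε * w := mul_le_of_le_one_right hε0 hB1
      have h3 := mul_le_mul_of_nonneg_right hP hB.le
      have h4 := mul_le_mul_of_nonneg_right hP2 hB.le
      -- Both terms lie between `h₀ * w * B` and `h₀ * w * B + ε * w`.
      have h5 : |(M * B - M' * (1 / Q) ^ d) * (1 / Q) ^ n| ≤ ε * (C * Q) * (1 / Q) ^ n := by
        rw [abs_le]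
        constructor <;> nlinarith
      rw [abs_mul, abs_of_pos hpn] at h5
      exact le_of_mul_le_mul_right h5 hpn

/-- A surjection of symbolic spaces whose preimages of cylinders are unions of cylinders of
comparable mass relates the masses of the letters: up to bounded integer factors, their powers are
powers of `1 / q`. -/
theorem exists_bounded_counts (hq : 1 < q) {b : Fin m → ℝ} (hb0 : ∀ i, 0 < b i)
    (hb1 : ∀ i, b i < 1) (hb : ∑ i, b i = 1) {G : (ℕ → Fin q) → ℕ → Fin m}
    (hsurj : Function.Surjective G) {C : ℝ} (hC : 1 ≤ C)
    (hG : ∀ u v n l, (∀ i < n, u i = v i) → C * (1 / (q : ℝ)) ^ n < ratioProd b (G u) l →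
      ∀ i < l, G u i = G v i) :
    ∃ K : ℕ, ∀ j t, ∃ M ≤ K, ∃ M' ≤ K, ∃ d : ℕ, 0 < M ∧ 0 < M' ∧
      (M : ℝ) * b j ^ t = M' * (1 / (q : ℝ)) ^ d := by
  classical
  have : NeZero q := ⟨by omega⟩
  have hQ : (2 : ℝ) ≤ q := by exact_mod_cast hq
  have hQ0 : (0 : ℝ) < q := by linarith
  have hR0 : 0 < 1 / (q : ℝ) := by positivity
  have hR1 : 1 / (q : ℝ) < 1 := by rw [div_lt_one hQ0]; linarith
  obtain ⟨μ, hμ, hcyl⟩ := exists_bernoulli (fun _ : Fin q => 1 / (q : ℝ)) (fun _ => hR0.le) (by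
    rw [Finset.sum_const, Finset.card_univ, Fintype.card_fin, nsmul_eq_mul]
    field_simp)
  let P : (ℕ → Fin m) → ℕ → ℝ := fun x l => μ.real (G ⁻¹' PiNat.cylinder x l)
  let w : (ℕ → Fin m) → ℕ → ℝ := ratioProd b
  have hw0 : ∀ x l, 0 < w x l := ratioProd_pos hb0
  -- The least admissible `n`, so that `w x l` exceeds the threshold by a factor of at most `q`.
  have hlevel : ∀ x l, ∃ n, C * (1 / (q : ℝ)) ^ n < w x l ∧ w x l ≤ C * q * (1 / (q : ℝ)) ^ n := by
    intro x l
    have hex : ∃ n, C * (1 / (q : ℝ)) ^ n < w x l := by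
      have ht := (tendsto_pow_atTop_nhds_zero_of_lt_one hR0.le hR1).const_mul C
      rw [mul_zero] at ht
      exact (ht.eventually (gt_mem_nhds (hw0 x l))).exists
    refine ⟨Nat.find hex, Nat.find_spec hex, ?_⟩
    rcases h : Nat.find hex with _ | n
    · have h1 : w x l ≤ 1 := ratioProd_le_one hb0 hb1 x l
      have h2 : 1 ≤ C * q := by nlinarith
      simpa using h1.trans h2
    · have h1 := not_lt.1 (Nat.find_min hex (m := n) (by omega))
      refine h1.trans (le_of_eq ?_)
      rw [pow_succ]
      field_simp
  have hcount : ∀ x l n, C * (1 / (q : ℝ)) ^ n < w x l → MeasurableSet (G ⁻¹' PiNat.cylinder x l) ∧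
      ∃ M : ℕ, P x l = M * (1 / (q : ℝ)) ^ n ∧ 0 < M := by
    intro x l n hn
    obtain ⟨h1, M, hM, hpos⟩ := measure_eq_natCast_mul hcyl (S := G ⁻¹' PiNat.cylinder x l) (n := n)
      (fun u hu v huv i hi => by
        have hwu : ratioProd b (G u) l = w x l := ratioProd_congr hu
        rw [← hG u v n l huv (by rwa [hwu]) i hi]
        exact hu i hi)
    obtain ⟨u, hu⟩ := hsurj x
    exact ⟨h1, M, hM, hpos ⟨u, by simp [hu]⟩⟩
  have hmeas : ∀ x l, MeasurableSet (G ⁻¹' PiNat.cylinder x l) := fun x l => by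
    obtain ⟨n, hn, -⟩ := hlevel x l
    exact (hcount x l n hn).1
  have hlow : ∀ x l, 1 / (C * q) ≤ P x l / w x l := by
    intro x l
    obtain ⟨n, hn, hn'⟩ := hlevel x l
    obtain ⟨-, M, hM, hM0⟩ := hcount x l n hn
    rw [div_le_div_iff₀ (by positivity) (hw0 x l), one_mul, hM]
    have h1 : (1 : ℝ) ≤ M := by exact_mod_cast hM0
    calc w x l ≤ 1 * (C * q * (1 / (q : ℝ)) ^ n) := by rwa [one_mul]
      _ ≤ M * (C * q * (1 / (q : ℝ)) ^ n) := by gcongr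
      _ = _ := by ring
  -- The set of densities; its infimum `h₀` need not be attained.
  let R : Set ℝ := Set.range fun z : (ℕ → Fin m) × ℕ => P z.1 z.2 / w z.1 z.2
  let h₀ := sInf R
  have hRne : R.Nonempty := ⟨_, (G 0, 0), rfl⟩
  have hbdd : BddBelow R := ⟨1 / (C * q), by rintro _ ⟨z, rfl⟩; exact hlow _ _⟩
  have hh₀ : 0 < h₀ := lt_of_lt_of_le (by positivity : (0 : ℝ) < 1 / (C * q))
    (le_csInf hRne (by rintro _ ⟨z, rfl⟩; exact hlow _ _))
  have hge : ∀ x l, h₀ * w x l ≤ P x l := fun x l =>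
    (le_div_iff₀ (hw0 x l)).1 (csInf_le hbdd ⟨(x, l), rfl⟩)
  have hcongr : ∀ x y l, (∀ i < l, x i = y i) → P x l = P y l := by
    intro x y l hxy
    have : PiNat.cylinder x l = PiNat.cylinder y l := PiNat.mem_cylinder_iff_eq.1 hxy
    simp only [P, this]
  have hPadd : ∀ x l, P x l = ∑ i, P (Function.update x l i) (l + 1) := by
    intro x l
    simp only [P]
    rw [← PiNat.iUnion_cylinder_update, Set.preimage_iUnion, measureReal_iUnion_fintype _
      fun i => hmeas _ _]
    intro i j hij
    refine Set.disjoint_left.2 fun u hu hu' => hij ?_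
    have h1 := hu l l.lt_succ_self
    have h2 := hu' l l.lt_succ_self
    rw [Function.update_self] at h1 h2
    rw [← h1, ← h2]
  have hwadd : ∀ x l, w x l = ∑ i, w (Function.update x l i) (l + 1) := by
    intro x l
    calc w x l = ∑ i, w x l * b i := by rw [← Finset.mul_sum, hb, mul_one]
      _ = _ := Finset.sum_congr rfl fun i _ => by
        simp only [w]
        rw [ratioProd_succ, Function.update_self]
        congr 1
        exact ratioProd_congr fun j hj => (Function.update_of_ne hj.ne _ _).symm
  -- The excess over the least density is nonnegative and additive over subcylinders.
  have hanti : ∀ x, Antitone fun l => P x l - h₀ * w x l := by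
    refine fun x => antitone_nat_of_succ_le fun l => ?_
    rw [hPadd x l, hwadd x l, Finset.mul_sum, ← Finset.sum_sub_distrib]
    have := Finset.single_le_sum (f := fun i => P (Function.update x l i) (l + 1) -
      h₀ * w (Function.update x l i) (l + 1)) (fun i _ => sub_nonneg.2 (hge _ _))
      (Finset.mem_univ (x l))
    simpa using this
  -- This bound is independent of `t`; only the range of `d` depends on it.
  refine ⟨⌈2 * h₀ * (C * q)⌉₊, fun j t => ?_⟩
  have hB0 : 0 < b j ^ t := pow_pos (hb0 j) t
  have hB1 : b j ^ t ≤ 1 := pow_le_one₀ (hb0 j).le (hb1 j).le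
  obtain ⟨⟨M, M', d⟩, hmem, hzero⟩ := exists_zero_of_forall_abs_le
    (Finset.Icc 1 ⌈2 * h₀ * (C * q)⌉₊ ×ˢ Finset.Icc 1 ⌈2 * h₀ * (C * q)⌉₊ ×ˢ
      Finset.range (⌈(q : ℝ) / b j ^ t⌉₊ + 1))
    (fun z => (z.1 : ℝ) * b j ^ t - z.2.1 * (1 / (q : ℝ)) ^ z.2.2)
    (mul_pos hh₀ hB0) (show 0 < C * q by positivity) (by
      intro ε hε hεle
      obtain ⟨_, ⟨⟨x₀, l⟩, rfl⟩, hx₀⟩ := exists_lt_of_csInf_lt hRne (lt_add_of_pos_right h₀ hε)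
      rw [div_lt_iff₀ (hw0 x₀ l)] at hx₀
      -- Continue the nearly extremal word by the letter `j`; `t` further letters multiply the mass
      -- by `b j ^ t`.
      let x : ℕ → Fin m := fun i => if i < l then x₀ i else j
      have hx : ∀ i < l, x₀ i = x i := fun i hi => (if_pos hi).symm
      have hP : P x l ≤ h₀ * w x l + ε * w x l := by
        rw [← hcongr _ _ _ hx, ← add_mul]
        have : w x₀ l = w x l := ratioProd_congr hx
        rw [← this]
        exact hx₀.le
      have hwt : w x (l + t) = w x l * b j ^ t := by
        simp only [w, ratioProd]
        rw [Finset.prod_range_add]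
        congr 1
        rw [← Finset.card_range t, ← Finset.prod_const, Finset.card_range]
        exact Finset.prod_congr rfl fun i _ => by simp [x]
      have hP' : P x (l + t) ≤ h₀ * (w x l * b j ^ t) + ε * w x l := by
        have := hanti x (Nat.le_add_right l t)
        simp only at this
        rw [← hwt]
        linarith
      obtain ⟨n, hn1, hn2⟩ := hlevel x l
      obtain ⟨n', hn1', hn2'⟩ := hlevel x (l + t)
      obtain ⟨-, M, hM, hM0⟩ := hcount x l n hn1
      obtain ⟨-, M', hM', hM0'⟩ := hcount x (l + t) n' hn1'
      have hge' := hge x (l + t)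
      rw [hwt] at hn1' hn2' hge'
      rw [hM'] at hP' hge'
      have hge'' := hge x l
      rw [hM] at hP hge''
      obtain ⟨h1, h2, d, hd, h3⟩ := nested_counts hQ hh₀ hεle hC hB0 hB1 (Nat.le_ceil _)
        (Nat.le_ceil _) (hw0 x l) hn1 hn2 hn1' hn2' hge'' hP hge' hP'
      exact ⟨(M, M', d), by simp only [Finset.mem_product, Finset.mem_Icc, Finset.mem_range]; omega, h3⟩)
  simp only [Finset.mem_product, Finset.mem_Icc] at hmem
  exact ⟨M, hmem.1.2, M', hmem.2.1.2, d, hmem.1.1, hmem.2.1.1, sub_eq_zero.1 hzero⟩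

/-- If a number and its powers are powers of `1 / a ^ k` up to bounded integer factors, and `a` is
not a perfect power, then the number is a power of `1 / a`. -/
theorem eq_pow_of_bounded_counts {a k K : ℕ} (ha : 2 ≤ a) (hk : 0 < k)
    (hpow : ∀ c e : ℕ, a = c ^ e → e = 1) {b : ℝ} (hb0 : 0 < b) (hb1 : b < 1)
    (h : ∀ t : ℕ, ∃ M ≤ K, ∃ M' ≤ K, ∃ d : ℕ, 0 < M ∧ 0 < M' ∧
      (M : ℝ) * b ^ t = M' * (1 / ((a ^ k : ℕ) : ℝ)) ^ d) :
    ∃ p : ℕ, 0 < p ∧ b = (1 / (a : ℝ)) ^ p := by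
  have ha0 : (0 : ℝ) < a := by positivity
  have hQ1 : 1 < a ^ k := Nat.one_lt_pow hk.ne' ha
  choose M hM M' hM' d hM0 hM0' heq using h
  set Q : ℕ := a ^ k with hQ
  have hQ0 : (0 : ℝ) < Q := by exact_mod_cast (by omega : 0 < Q)
  have heq' : ∀ t, (M t : ℝ) * b ^ t * Q ^ d t = M' t := fun t => by
    rw [heq, one_div, inv_pow]
    field_simp
  -- Two exponents with the same pair `(M, M')` exist by pigeonhole; dividing their relations
  -- cancels the integers.
  obtain ⟨τ, D, hτ, hτD⟩ : ∃ τ D : ℕ, 0 < τ ∧ b ^ τ * (Q : ℝ) ^ D = 1 := by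
    obtain ⟨t₁, t₂, hlt, ht⟩ : ∃ t₁ t₂ : ℕ, t₁ < t₂ ∧ M t₁ = M t₂ ∧ M' t₁ = M' t₂ := by
      obtain ⟨x, y, hne, hxy⟩ := Finite.exists_ne_map_eq_of_infinite fun t =>
        ((⟨M t, Nat.lt_succ_of_le (hM t)⟩, ⟨M' t, Nat.lt_succ_of_le (hM' t)⟩) :
          Fin (K + 1) × Fin (K + 1))
      simp only [Prod.mk.injEq, Fin.mk.injEq] at hxy
      rcases lt_or_gt_of_ne hne with hlt | hlt
      · exact ⟨x, y, hlt, hxy⟩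
      · exact ⟨y, x, hlt, hxy.1.symm, hxy.2.symm⟩
    obtain ⟨τ, rfl⟩ := Nat.exists_eq_add_of_lt hlt
    have h1 := heq' t₁
    have h2 := heq' (t₁ + τ + 1)
    rw [← ht.1, ← ht.2, ← h1] at h2
    have hMp : (0 : ℝ) < M t₁ := by exact_mod_cast hM0 t₁
    have hbt : 0 < b ^ t₁ := pow_pos hb0 _
    have h3 : b ^ (τ + 1) * (Q : ℝ) ^ d (t₁ + τ + 1) = Q ^ d t₁ := by
      refine mul_left_cancel₀ (mul_pos hMp hbt).ne' ?_
      rw [← h2]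
      ring
    have hlt1 : b ^ (τ + 1) < 1 := pow_lt_one₀ hb0.le hb1 τ.succ_ne_zero
    have hd : d t₁ < d (t₁ + τ + 1) := by
      by_contra hle
      have h4 : (Q : ℝ) ^ d (t₁ + τ + 1) ≤ Q ^ d t₁ :=
        pow_le_pow_right₀ (by exact_mod_cast hQ1.le) (not_lt.1 hle)
      have h5 : 0 < (Q : ℝ) ^ d (t₁ + τ + 1) := pow_pos hQ0 _
      nlinarith
    obtain ⟨D, hD⟩ := Nat.exists_eq_add_of_lt hd
    refine ⟨τ + 1, D + 1, τ.succ_pos, mul_left_cancel₀ (pow_pos hQ0 (d t₁)).ne' ?_⟩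
    rw [mul_one]
    conv_rhs => rw [← h3, hD]
    ring
  have hy : b⁻¹ ^ τ = ((a ^ (k * D) : ℕ) : ℤ) := by
    rw [inv_pow, eq_comm, ← mul_eq_one_iff_eq_inv₀ (pow_pos hb0 _).ne', ← hτD, hQ, pow_mul]
    push_cast
    ring
  -- A root of an integer is an integer or irrational, and the relation for `t = 1` makes `b⁻¹`
  -- rational.
  obtain ⟨z, hz⟩ : ∃ z : ℤ, b⁻¹ = z := by
    by_contra hno
    refine irrational_nrt_of_notint_nrt τ _ hy hno hτ ⟨M 1 * Q ^ d 1 / M' 1, ?_⟩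
    have h1 := heq' 1
    have h2 : (0 : ℝ) < M' 1 := by exact_mod_cast hM0' 1
    push_cast
    rw [div_eq_iff h2.ne', ← h1]
    field_simp
  have hz0 : 0 < z := by
    have : (0 : ℝ) < z := hz ▸ inv_pos.2 hb0
    exact_mod_cast this
  lift z to ℕ using hz0.le
  have hz' : z ^ τ = a ^ (k * D) := by
    rw [hz] at hy
    exact_mod_cast hy
  -- Equal powers have a common base `c`; as `a` is not a perfect power, `c = a`.
  obtain ⟨c, hc1, hc2⟩ := Nat.exists_eq_pow_of_pow_eq_pow (Or.inl hτ.ne') hz'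
  rw [hpow _ _ hc2, pow_one] at hc2
  subst hc2
  have hb : b = (1 / (a : ℝ)) ^ (k * D / Nat.gcd τ (k * D)) := by
    rw [← inv_inv b, hz, hc1]
    simp
  refine ⟨_, Nat.pos_of_ne_zero fun h0 => ?_, hb⟩
  rw [h0, pow_zero] at hb
  exact hb1.ne hb

end Counting

/-! ### Primitive root, symbolic surjection and the theorem. -/

/-- The largest integral root of `q` is not a perfect power. -/
theorem exists_primitive_root {q k : ℕ} (hq : 1 < q)
    (hk : IsGreatest {l : ℕ | 0 < l ∧ ∃ a : ℤ, (q : ℝ) ^ (1 / (l : ℝ)) = (a : ℝ)} k) :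
    ∃ a : ℕ, q = a ^ k ∧ 2 ≤ a ∧ ∀ c e : ℕ, a = c ^ e → e = 1 := by
  obtain ⟨⟨hk0, z, hz⟩, hmax⟩ := hk
  have hk' : (k : ℝ) ≠ 0 := by positivity
  have hz0 : (0 : ℝ) < z := hz ▸ Real.rpow_pos_of_pos (by positivity) _
  lift z to ℕ using (by exact_mod_cast hz0.le)
  have hqz : q = z ^ k := by
    have : (q : ℝ) = (z : ℝ) ^ k := by
      have h1 : (q : ℝ) ^ (1 / (k : ℝ)) = z := by exact_mod_cast hz
      rw [← h1, one_div, Real.rpow_inv_natCast_pow (by positivity) hk0.ne']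
    exact_mod_cast this
  have hz2 : 2 ≤ z := by
    by_contra hlt
    have : z ≤ 1 := by omega
    have := Nat.pow_le_one_iff hk0.ne' |>.2 this
    omega
  refine ⟨z, hqz, hz2, fun c e hce => ?_⟩
  have he : e ≠ 0 := by
    rintro rfl
    simp at hce
    omega
  -- If the root were `c ^ e`, then `q = c ^ (e * k)`, and maximality of `k` gives `e ≤ 1`.
  have hek : e * k ∈ {l : ℕ | 0 < l ∧ ∃ a : ℤ, (q : ℝ) ^ (1 / (l : ℝ)) = (a : ℝ)} := by
    refine ⟨Nat.mul_pos (Nat.pos_of_ne_zero he) hk0, c, ?_⟩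
    rw [hqz, hce, ← pow_mul, Nat.cast_pow, one_div,
      Real.pow_rpow_inv_natCast (by positivity) (Nat.mul_pos (Nat.pos_of_ne_zero he) hk0).ne']
    simp
  have h1 : e ≤ 1 := Nat.le_of_mul_le_mul_right (by simpa using hmax hek) hk0
  omega

/-- Through the codings, a Lipschitz surjection becomes a surjection of symbolic spaces that maps
small cylinders into cylinders of comparable mass. -/
theorem exists_symbolic_surjection {X Y ι κ : Type*} [MetricSpace X] [MetricSpace Y] [Finite ι]
    [Finite κ] {h : ι → X → X} {h' : κ → Y → Y} {r : ℝ} {β : κ → ℝ}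
    (H : IsDustLike (fun x y : X => dist x y) h fun _ => r)
    (H' : IsDustLike (fun x y : Y => dist x y) h' β) (hr : 0 < r) {s : ℝ} (hs : 0 < s)
    (hXY : LipschitzMapsOnto X Y) :
    ∃ G : (ℕ → ι) → ℕ → κ, Function.Surjective G ∧ ∃ C : ℝ, 1 ≤ C ∧
      ∀ u v n l, (∀ i < n, u i = v i) →
        C * (r ^ s) ^ n < ratioProd (fun i => β i ^ s) (G u) l → ∀ i < l, G u i = G v i := by
  obtain ⟨f, hf, L, hL⟩ := hXY
  obtain ⟨D', hD'⟩ := H.bounded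
  obtain ⟨D, hD, hD0⟩ : ∃ D, (∀ x y : X, dist x y ≤ D) ∧ 0 ≤ D :=
    ⟨max D' 0, fun x y => (hD' x y).trans (le_max_left _ _), le_max_right _ _⟩
  obtain ⟨δ, hδ0, hδ⟩ := H'.separated
  let E := Equiv.ofBijective _ H'.code_bijective
  have hE : ∀ y, H'.code (E.symm y) = y := E.apply_symm_apply
  refine ⟨fun u => E.symm (f (H.code u)),
    E.symm.surjective.comp (hf.comp H.code_surjective), max 1 ((L * D / δ) ^ s), le_max_left _ _,
    fun u v n l huv hlt i hi => H'.agree_of_dist_code_lt hδ0.le hδ (l := l) ?_ i hi.le⟩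
  rw [hE, hE]
  have hw := (ratioProd_pos H'.ratio_pos (E.symm (f (H.code u))) l)
  rw [ratioProd_rpow H'.ratio_pos] at hlt
  -- The constant is chosen so that the image of an `n`-cylinder has diameter below the gap `δ`
  -- times the ratio product.
  have h1 : (L * D / δ * r ^ n) ^ s < ratioProd β (E.symm (f (H.code u))) l ^ s := by
    refine lt_of_le_of_lt ?_ hlt
    rw [Real.mul_rpow (by positivity) (by positivity), ← Real.rpow_natCast, ← Real.rpow_natCast,
      ← Real.rpow_mul hr.le, ← Real.rpow_mul hr.le, mul_comm s]
    exact mul_le_mul_of_nonneg_right (le_max_right _ _) (Real.rpow_nonneg hr.le _)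
  have h2 := (Real.rpow_lt_rpow_iff (by positivity) hw.le hs).1 h1
  have h3 := H.dist_code_le hD huv
  rw [ratioProd, Finset.prod_const, Finset.card_range] at h3
  calc dist (f (H.code u)) (f (H.code v)) ≤ L * dist (H.code u) (H.code v) := hL.dist_le_mul _ _
    _ ≤ L * (r ^ n * D) := by gcongr
    _ = L * D / δ * r ^ n * δ := by field_simp
    _ < _ := mul_lt_mul_of_pos_right h2 hδ0

theorem theorem6p7 {n n' q m k : ℕ} (hq : 1 < q)
    (f : Fin q → EuclideanSpace ℝ (Fin n) → EuclideanSpace ℝ (Fin n)) (r : ℝ)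
    (A : Set (EuclideanSpace ℝ (Fin n)))
    (hA : IsSelfSimilarSet f (fun _ => r) A) (hAsep : StrongSeparation f A)
    (hk : IsGreatest {l : ℕ | 0 < l ∧ ∃ a : ℤ, (q : ℝ) ^ (1 / (l : ℝ)) = (a : ℝ)} k)
    (g : Fin m → EuclideanSpace ℝ (Fin n') → EuclideanSpace ℝ (Fin n')) (β : Fin m → ℝ)
    (B : Set (EuclideanSpace ℝ (Fin n')))
    (hB : IsSelfSimilarSet g β B) (hBsep : StrongSeparation g B)
    (hdim : dimH A = dimH B) :
    List.TFAE [LipschitzMapsOnto A B,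
      ∀ j, ∃ p : ℕ, 0 < p ∧ β j = (r ^ (1 / (k : ℝ))) ^ p,
      BilipschitzEquivalent A B] := by
  obtain ⟨a, hqa, ha, hpow⟩ := exists_primitive_root hq hk
  have hk0 : 0 < k := hk.1.1
  have hr0 : 0 < r := hA.ratio_pos ⟨0, by omega⟩
  have hr1 : r < 1 := hA.ratio_lt_one ⟨0, by omega⟩
  obtain ⟨hf, HA⟩ := hA.exists_isDustLike hAsep
  obtain ⟨hg, HB⟩ := hB.exists_isDustLike hBsep
  obtain ⟨s, hsA, hs⟩ := hA.exists_moran hAsep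
  obtain ⟨t, htB, ht⟩ := hB.exists_moran hBsep
  obtain rfl : s = t := by
    rw [hsA, htB] at hdim
    exact_mod_cast hdim
  have hrs : r ^ (s : ℝ) = 1 / q := by
    rw [Finset.sum_const, Finset.card_univ, Fintype.card_fin, nsmul_eq_mul] at hs
    rw [eq_div_iff (by positivity), mul_comm, hs]
  have hs0 : (0 : ℝ) < s := by
    refine lt_of_le_of_ne s.coe_nonneg fun h0 => ?_
    rw [← h0, Real.rpow_zero, eq_div_iff (by positivity), one_mul] at hrs
    have : q = 1 := by exact_mod_cast hrs
    omega
  set ρ : ℝ := r ^ (1 / (k : ℝ)) with hρ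
  have hρ0 : 0 < ρ := Real.rpow_pos_of_pos hr0 _
  have hρ1 : ρ < 1 := Real.rpow_lt_one hr0.le hr1 (by positivity)
  have hρk : ρ ^ k = r := by rw [hρ, one_div, Real.rpow_inv_natCast_pow hr0.le hk0.ne']
  have hρs : ρ ^ (s : ℝ) = 1 / a := by
    refine (pow_left_inj₀ (Real.rpow_nonneg hρ0.le _) (by positivity) hk0.ne').1 ?_
    rw [← Real.rpow_natCast, ← Real.rpow_mul hρ0.le, mul_comm, Real.rpow_mul hρ0.le,
      Real.rpow_natCast, hρk, hrs, hqa]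
    simp
  have hρp : ∀ p : ℕ, (ρ ^ p) ^ (s : ℝ) = (1 / (a : ℝ)) ^ p := fun p => by
    rw [← hρs, ← Real.rpow_natCast, ← Real.rpow_natCast, ← Real.rpow_mul hρ0.le,
      ← Real.rpow_mul hρ0.le, mul_comm]
  tfae_have 1 → 2 := by
    intro hAB j
    obtain ⟨G, hG, C, hC, hGC⟩ := exists_symbolic_surjection HA HB hr0 hs0 hAB
    rw [hrs] at hGC
    obtain ⟨K, hK⟩ := exists_bounded_counts hq (fun i => Real.rpow_pos_of_pos (hB.ratio_pos i) _)
      (fun i => Real.rpow_lt_one (hB.ratio_pos i).le (hB.ratio_lt_one i) hs0) ht hG hC hGC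
    have hKj := hK j
    rw [hqa] at hKj
    obtain ⟨p, hp, hbp⟩ := eq_pow_of_bounded_counts ha hk0 hpow
      (Real.rpow_pos_of_pos (hB.ratio_pos j) _)
      (Real.rpow_lt_one (hB.ratio_pos j).le (hB.ratio_lt_one j) hs0) hKj
    refine ⟨p, hp, ?_⟩
    rw [← hρp] at hbp
    exact (Real.rpow_left_inj (hB.ratio_pos j).le (pow_nonneg hρ0.le p) hs0.ne').1 hbp
  tfae_have 2 → 3 := by
    intro h
    choose p hp hβp using h
    have hβ : β = fun j => ρ ^ p j := funext hβp
    -- The `q = a ^ k` maps of `A` correspond to code words that all have length `k`.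
    obtain ⟨h₁, H₁⟩ := exists_isDustLike_addressDist (m := q) (p := fun _ => k) ha hρ0 hρ1
      (fun _ => hk0) (by
        rw [Finset.sum_const, Finset.card_univ, Fintype.card_fin, nsmul_eq_mul, hqa, one_div,
          inv_pow, Nat.cast_pow]
        exact mul_inv_cancel₀ (by positivity))
    obtain ⟨h₂, H₂⟩ := exists_isDustLike_addressDist ha hρ0 hρ1 hp (by
      refine Eq.trans (Finset.sum_congr rfl fun j _ => ?_) ht
      rw [hβp, hρp])
    rw [hρk] at H₁
    rw [← hβ] at H₂
    obtain ⟨e₁, ⟨C₁, hC₁, h1⟩, C₁', hC₁', h1'⟩ := HA.exists_equiv H₁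
    obtain ⟨e₂, ⟨C₂, hC₂, h2⟩, C₂', hC₂', h2'⟩ := H₂.exists_equiv HB
    refine ⟨e₁.trans e₂, ⟨⟨C₂ * C₁, by positivity⟩, LipschitzWith.of_dist_le_mul fun x y => ?_⟩,
      ⟨⟨C₁' * C₂', by positivity⟩, LipschitzWith.of_dist_le_mul fun x y => ?_⟩⟩
    · calc dist (e₂ (e₁ x)) (e₂ (e₁ y)) ≤ C₂ * addressDist ρ (e₁ x) (e₁ y) := h2 _ _
        _ ≤ C₂ * (C₁ * dist x y) := mul_le_mul_of_nonneg_left (h1 _ _) hC₂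
        _ = C₂ * C₁ * dist x y := by ring
    · calc dist (e₁.symm (e₂.symm x)) (e₁.symm (e₂.symm y))
          ≤ C₁' * addressDist ρ (e₂.symm x) (e₂.symm y) := h1' _ _
        _ ≤ C₁' * (C₂' * dist x y) := mul_le_mul_of_nonneg_left (h2' _ _) hC₁'
        _ = C₁' * C₂' * dist x y := by ring
  tfae_have 3 → 1 := fun ⟨e, he, _⟩ => ⟨e, e.surjective, he⟩
  tfae_finish
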